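/- Let $\|\cdot\|$ denote the Euclidean norm of vectors and the spectral norm of matrices. Let $\lambda_1\in\mathbb R$, let $D_2\in\mathbb C^{q\times q}$ be Hermitian, $D_1=\lambda_1 I\in\mathbb C^{p\times p}$, and let $E_1,B_1\in\mathbb C^{p\times q}$ satisfy $E_1=D_1B_1-B_1D_2$. Put $$D=\begin{bmatrix}D_1&0\\0&D_2\end{bmatrix},\quad E=\begin{bmatrix}0&E_1\\E_1^*&0\end{bmatrix},\quad B=\begin{bmatrix}0&B_1\\B_2&0\end{bmatrix},\ B_2=-B_1^*,\qquad \mathrm{gap}=\min_{\mu\in\Lambda(D_2)}|\lambda_1-\mu| .$$ For $t\in[0,1]$ let $\lambda_i(t)$ be the $i$-th eigenvalue of $D+tE$ (eigenvalues are listed in decreasing order, with multiplicity), and let $i$ be such that $\lambda_i(0)$ is an eigenvalue of $D_1$. Let $x_i(t)$ be any eigenvector of $D+tE$ for $\lambda_i(t)$ with $\|x_i(t)\|=1$, and decompose it as $$x_i(t)=\begin{bmatrix}I\\-tB_2\end{bmatrix}x_i^{(top)}(t)+\begin{bmatrix}0\\r_i(t)\end{bmatrix},$$ where $x_i^{(top)}(t)\in\mathbb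 C^p$ consists of the first $p$ entries of $x_i(t)$ (this determines $r_i(t)\in\mathbb C^q$). (a) If $\|E_1\|<\mathrm{gap}$, then $$\|r_i(t)\|\le\frac{1}{\mathrm{gap}-\|E_1\|}\left(\frac{t^2}{2}\|B_1\|\,\|B_1E_1^*+E_1B_1^*\|+\frac23t^3\frac{\|B_1\|^2\|E_1\|^2}{\mathrm{gap}-\|E_1\|}\right).$$ (b) For every real $\rho_0<1$ there is a constant $C>0$, depending only on $\rho_0$, such that whenever $\mathrm{gap}>0$ and $\|E\|/\mathrm{gap}\le\rho_0$, $$\|r_i(t)\|\le C\left(\frac{\|E\|}{\mathrm{gap}}\right)^3 .$$ -/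

import Mathlib

-- `‖A‖` for a (rectangular) complex matrix `A` is the spectral norm.
open scoped Matrix.Norms.L2Operator

namespace BlockPerturbation

open Matrix

/-- The upper-left block `D₁ = λ₁ I`. -/
def blockD₁ (p : ℕ) (lam₁ : ℝ) : Matrix (Fin p) (Fin p) ℂ :=
  (lam₁ : ℂ) • 1

/-- The block diagonal matrix `D = [D₁, 0; 0, D₂]` with `D₁ = λ₁ I`. -/
def blockD {p q : ℕ} (lam₁ : ℝ) (D₂ : Matrix (Fin q) (Fin q) ℂ) :
    Matrix (Fin p ⊕ Fin q) (Fin p ⊕ Fin q) ℂ :=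
  fromBlocks (blockD₁ p lam₁) 0 0 D₂

/-- The Hermitian perturbation `E = [0, E₁; E₁*, 0]`. -/
def blockE {p q : ℕ} (E₁ : Matrix (Fin p) (Fin q) ℂ) :
    Matrix (Fin p ⊕ Fin q) (Fin p ⊕ Fin q) ℂ :=
  fromBlocks 0 E₁ E₁ᴴ 0

/-- The lower-left block `B₂ = -B₁*` of `B = [0, B₁; -B₁*, 0]`. -/
def blockB₂ {p q : ℕ} (B₁ : Matrix (Fin p) (Fin q) ℂ) : Matrix (Fin q) (Fin p) ℂ :=
  -B₁ᴴ

/-- `gap = min {|λ₁ - μ| : μ ∈ Λ(D₂)}`. -/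
noncomputable def gap {q : ℕ} (lam₁ : ℝ) (D₂ : Matrix (Fin q) (Fin q) ℂ) : ℝ :=
  sInf ((fun μ : ℂ => ‖(lam₁ : ℂ) - μ‖) '' spectrum ℂ D₂)

/-- `D + t E`. -/
noncomputable def perturbed {p q : ℕ} (lam₁ : ℝ) (D₂ : Matrix (Fin q) (Fin q) ℂ)
    (E₁ : Matrix (Fin p) (Fin q) ℂ) (t : ℝ) :
    Matrix (Fin p ⊕ Fin q) (Fin p ⊕ Fin q) ℂ :=
  blockD lam₁ D₂ + (t : ℂ) • blockE E₁

theorem isHermitian_perturbed {p q : ℕ} (lam₁ : ℝ) {D₂ : Matrix (Fin q) (Fin q) ℂ}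
    (hD₂ : D₂.IsHermitian) (E₁ : Matrix (Fin p) (Fin q) ℂ) (t : ℝ) :
    (perturbed lam₁ D₂ E₁ t).IsHermitian := by
  simp [perturbed, blockD, blockD₁, blockE, Matrix.IsHermitian, fromBlocks_conjTranspose,
    hD₂.eq]

/-- `λ_i(t)`, the `i`-th eigenvalue of `D + t E`; the eigenvalues are counted with multiplicity
and listed in decreasing order. -/
noncomputable def eigenvalueAt {p q : ℕ} (lam₁ : ℝ) {D₂ : Matrix (Fin q) (Fin q) ℂ}
    (hD₂ : D₂.IsHermitian) (E₁ : Matrix (Fin p) (Fin q) ℂ)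
    (i : Fin (Fintype.card (Fin p ⊕ Fin q))) (t : ℝ) : ℝ :=
  (isHermitian_perturbed lam₁ hD₂ E₁ t).eigenvalues₀ i

/-- `x` is a normalized eigenvector of `D + t E` for the eigenvalue `λ_i(t)`. -/
def IsUnitEigenvectorAt {p q : ℕ} (lam₁ : ℝ) {D₂ : Matrix (Fin q) (Fin q) ℂ}
    (hD₂ : D₂.IsHermitian) (E₁ : Matrix (Fin p) (Fin q) ℂ)
    (i : Fin (Fintype.card (Fin p ⊕ Fin q))) (t : ℝ)
    (x : EuclideanSpace ℂ (Fin p ⊕ Fin q)) : Prop :=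
  ‖x‖ = 1 ∧
    perturbed lam₁ D₂ E₁ t *ᵥ x.ofLp = (eigenvalueAt lam₁ hD₂ E₁ i t : ℂ) • x.ofLp

/-- `x = [I; -t B₂] x_top + [0; r]`. -/
def IsDecomposition {p q : ℕ} (B₁ : Matrix (Fin p) (Fin q) ℂ) (t : ℝ)
    (x : EuclideanSpace ℂ (Fin p ⊕ Fin q)) (xtop : EuclideanSpace ℂ (Fin p))
    (r : EuclideanSpace ℂ (Fin q)) : Prop :=
  x.ofLp = fromRows 1 (-((t : ℂ) • blockB₂ B₁)) *ᵥ xtop.ofLp + Sum.elim (0 : Fin p → ℂ) r.ofLp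

/-- The decomposition exists and is unique. -/
theorem existsUnique_isDecomposition {p q : ℕ} (B₁ : Matrix (Fin p) (Fin q) ℂ) (t : ℝ)
    (x : EuclideanSpace ℂ (Fin p ⊕ Fin q)) :
    ∃! y : EuclideanSpace ℂ (Fin p) × EuclideanSpace ℂ (Fin q),
      IsDecomposition B₁ t x y.1 y.2 := by
  refine ⟨(WithLp.toLp 2 fun a => x (Sum.inl a), WithLp.toLp 2 ((fun b => x (Sum.inr b)) -
    (-((t : ℂ) • blockB₂ B₁)) *ᵥ fun a => x (Sum.inl a))), ?_, ?_⟩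
  · funext j
    cases j <;> simp [fromRows_mulVec]
  · rintro ⟨u, v⟩ h
    have h1 : u.ofLp = fun a => x (Sum.inl a) := by
      funext a
      have := congrFun h (Sum.inl a)
      simpa [fromRows_mulVec] using this.symm
    have h2 : v.ofLp = (fun b => x (Sum.inr b)) -
        (-((t : ℂ) • blockB₂ B₁)) *ᵥ fun a => x (Sum.inl a) := by
      funext b
      have := congrFun h (Sum.inr b)
      rw [← h1]
      simp [fromRows_mulVec] at this ⊢
      simp [this]
    ext j
    · exact congrFun h1 j
    · exact congrFun h2 j

end BlockPerturbation

namespace BlockPerturbation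

open Matrix

/-! Write `g = gap`, `e = ‖E₁‖`, `a = λ_i(t)`, `η = |a - λ₁|`, `u` for the top part of `x` and `y`
for its bottom part. The eigenvector equation reads `(a - λ₁) u = t E₁ y` and `(D₂ - a) y = -t E₁*
u`. Since `D₁` is scalar, `E₁* = (λ₁ - D₂) B₁*`, and substituting `y = t B₁* u + r` leaves `(D₂ - a)
r = t (a - λ₁) B₁* u`. As `D₂` is Hermitian, `D₂ - a` is bounded below by `g - η`, so `r` is
controlled by `η`. The eigenvalue shift is of second order: `g η ≤ (t e)²`, by a Courant–Fischer
argument and completion of a square (`gap_mul_abs_eigenvalueAt_sub_le`). In particular `g - η ≥ g -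
e`. For (a), pairing the top equation with `u` bounds `η` by the symmetrized product `B₁ E₁* + E₁
B₁*` plus a term in `r`; a cruder bound on `r` is fed into that term
(`remainder_le_of_inequalities`). For (b), the estimates chain with `g ‖B₁‖ ≤ e` into `g (g - e)²
‖r‖ ≤ e³` (`remainder_le_cube`). -/

/-- The first `p` entries of a vector. -/
noncomputable def top {p q : ℕ} (x : EuclideanSpace ℂ (Fin p ⊕ Fin q)) : EuclideanSpace ℂ (Fin p) :=
  WithLp.toLp 2 fun a => x (Sum.inl a)

/-- The last `q` entries of a vector. -/
noncomputable def bot {p q : ℕ} (x : EuclideanSpace ℂ (Fin p ⊕ Fin q)) : EuclideanSpace ℂ (Fin q) :=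
  WithLp.toLp 2 fun b => x (Sum.inr b)

/-- The vector with prescribed first and last entries. -/
noncomputable def glue {p q : ℕ} (u : EuclideanSpace ℂ (Fin p)) (v : EuclideanSpace ℂ (Fin q)) :
    EuclideanSpace ℂ (Fin p ⊕ Fin q) :=
  WithLp.toLp 2 (Sum.elim u.ofLp v.ofLp)

/-! ### Block coordinates. -/

section Split

variable {p q : ℕ}

@[simp] theorem top_glue (u : EuclideanSpace ℂ (Fin p)) (v : EuclideanSpace ℂ (Fin q)) :
    top (glue u v) = u := rfl

@[simp] theorem bot_glue (u : EuclideanSpace ℂ (Fin p)) (v : EuclideanSpace ℂ (Fin q)) :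
    bot (glue u v) = v := rfl

theorem ext_top_bot {x y : EuclideanSpace ℂ (Fin p ⊕ Fin q)} (h1 : top x = top y)
    (h2 : bot x = bot y) : x = y := by
  ext j
  cases j with
  | inl a => exact congrArg (fun z : EuclideanSpace ℂ (Fin p) => z a) h1
  | inr b => exact congrArg (fun z : EuclideanSpace ℂ (Fin q) => z b) h2

@[simp] theorem top_smul (c : ℂ) (x : EuclideanSpace ℂ (Fin p ⊕ Fin q)) :
    top (c • x) = c • top x := rfl

@[simp] theorem bot_smul (c : ℂ) (x : EuclideanSpace ℂ (Fin p ⊕ Fin q)) :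
    bot (c • x) = c • bot x := rfl

theorem inner_eq_top_add_bot (x y : EuclideanSpace ℂ (Fin p ⊕ Fin q)) :
    inner ℂ x y = inner ℂ (top x) (top y) + inner ℂ (bot x) (bot y) := by
  simp [PiLp.inner_apply, Fintype.sum_sum_type, top, bot]

theorem norm_sq_eq_top_add_bot (x : EuclideanSpace ℂ (Fin p ⊕ Fin q)) :
    ‖x‖ ^ 2 = ‖top x‖ ^ 2 + ‖bot x‖ ^ 2 := by
  simp [EuclideanSpace.norm_sq_eq, Fintype.sum_sum_type, top, bot]

theorem top_perturbed (lam₁ : ℝ) (D₂ : Matrix (Fin q) (Fin q) ℂ)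
    (E₁ : Matrix (Fin p) (Fin q) ℂ) (t : ℝ) (x : EuclideanSpace ℂ (Fin p ⊕ Fin q)) :
    top (toLpLin 2 2 (perturbed lam₁ D₂ E₁ t) x) =
      (lam₁ : ℂ) • top x + (t : ℂ) • toLpLin 2 2 E₁ (bot x) := by
  ext a
  simp [top, bot, perturbed, blockD, blockD₁, blockE, fromBlocks_mulVec, smul_mulVec,
    Function.comp_def]

theorem bot_perturbed (lam₁ : ℝ) (D₂ : Matrix (Fin q) (Fin q) ℂ)
    (E₁ : Matrix (Fin p) (Fin q) ℂ) (t : ℝ) (x : EuclideanSpace ℂ (Fin p ⊕ Fin q)) :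
    bot (toLpLin 2 2 (perturbed lam₁ D₂ E₁ t) x) =
      toLpLin 2 2 D₂ (bot x) + (t : ℂ) • toLpLin 2 2 E₁ᴴ (top x) := by
  ext b
  simp [top, bot, perturbed, blockD, blockD₁, blockE, fromBlocks_mulVec, smul_mulVec,
    Function.comp_def]

end Split

/-! ### Spectral norms and adjoints. -/

theorem norm_toLpLin_le {m n : Type*} [Fintype m] [Fintype n] [DecidableEq m] [DecidableEq n]
    (A : Matrix m n ℂ) (x : EuclideanSpace ℂ n) : ‖toLpLin 2 2 A x‖ ≤ ‖A‖ * ‖x‖ :=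
  l2_opNorm_mulVec A x

theorem norm_le_of_forall_toLpLin {m n : Type*} [Fintype m] [Fintype n] [DecidableEq m]
    [DecidableEq n] {A : Matrix m n ℂ} {c : ℝ} (hc : 0 ≤ c)
    (h : ∀ x : EuclideanSpace ℂ n, ‖toLpLin 2 2 A x‖ ≤ c * ‖x‖) : ‖A‖ ≤ c := by
  rw [l2_opNorm_def]
  exact ContinuousLinearMap.opNorm_le_bound _ hc h

theorem inner_toLpLin_conjTranspose {m n : Type*} [Fintype m] [Fintype n] [DecidableEq m]
    [DecidableEq n] (A : Matrix m n ℂ) (x : EuclideanSpace ℂ m) (y : EuclideanSpace ℂ n) :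
    inner ℂ (toLpLin 2 2 Aᴴ x) y = inner ℂ x (toLpLin 2 2 A y) := by
  have := LinearMap.adjoint_inner_left (toEuclideanLin A) y x
  rwa [← toEuclideanLin_conjTranspose_eq_adjoint] at this

theorem norm_le_norm_blockE {p q : ℕ} (E₁ : Matrix (Fin p) (Fin q) ℂ) : ‖E₁‖ ≤ ‖blockE E₁‖ := by
  refine norm_le_of_forall_toLpLin (norm_nonneg _) fun y => ?_
  have h1 : top (toLpLin 2 2 (blockE E₁) (glue 0 y)) = toLpLin 2 2 E₁ y := by
    ext a
    simp [top, glue, blockE, fromBlocks_mulVec, Function.comp_def]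
  have h2 : ‖glue (p := p) 0 y‖ = ‖y‖ := by
    have := norm_sq_eq_top_add_bot (glue (p := p) 0 y)
    rw [top_glue, bot_glue, norm_zero] at this
    exact (pow_left_inj₀ (norm_nonneg _) (norm_nonneg _) two_ne_zero).1 (by linarith)
  rw [← h1, ← h2]
  refine le_trans ?_ (norm_toLpLin_le _ _)
  have := norm_sq_eq_top_add_bot (toLpLin 2 2 (blockE E₁) (glue 0 y))
  exact abs_le_of_sq_le_sq' (by nlinarith [sq_nonneg ‖bot (toLpLin 2 2 (blockE E₁) (glue 0 y))‖])
    (norm_nonneg _) |>.2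

/-! ### Eigenbases of symmetric operators and intersections of spectral subspaces. -/

section Courant

variable {H : Type*} [NormedAddCommGroup H] [InnerProductSpace ℂ H] [FiniteDimensional ℂ H] {m : ℕ}

/-- Dimension count: the conditions number `(m - |S|) + (m - |T|) < m`, so their joint kernel is
nontrivial. -/
theorem exists_ne_zero_inner_eq_zero (φ ψ : OrthonormalBasis (Fin m) ℂ H) (S T : Finset (Fin m))
    (h : m < S.card + T.card) :
    ∃ x : H, x ≠ 0 ∧ (∀ j ∉ S, inner ℂ (φ j) x = 0) ∧ ∀ j ∉ T, inner ℂ (ψ j) x = 0 := by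
  let F : H →ₗ[ℂ] ({j // j ∉ S} → ℂ) × ({j // j ∉ T} → ℂ) :=
    (LinearMap.pi fun j => (innerₛₗ ℂ (φ j.1))).prod (LinearMap.pi fun j => (innerₛₗ ℂ (ψ j.1)))
  have hF : LinearMap.ker F ≠ ⊥ := by
    apply LinearMap.ker_ne_bot_of_finrank_lt
    have hH : Module.finrank ℂ H = m := by
      simpa using Module.finrank_eq_card_basis φ.toBasis
    have hS := S.card_le_univ
    have hT := T.card_le_univ
    rw [Module.finrank_prod, Module.finrank_pi, Module.finrank_pi, hH]
    simp only [Fintype.card_subtype_compl, Fintype.card_fin, Fintype.card_coe] at hS hT ⊢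
    omega
  obtain ⟨x, hx, hx0⟩ := (Submodule.ne_bot_iff _).1 hF
  rw [LinearMap.mem_ker] at hx
  refine ⟨x, hx0, fun j hj => ?_, fun j hj => ?_⟩
  · exact congrFun (congrArg Prod.fst hx) ⟨j, hj⟩
  · exact congrFun (congrArg Prod.snd hx) ⟨j, hj⟩

/-- The two sets contain the indices up to `i` and from `i` on, which overlap in `i`. The sign `σ`
serves upper and lower eigenvalue bounds at once; `σ = -1` swaps the two index ranges. -/
theorem lt_card_add_card_of_antitone {f g : Fin m → ℝ} (hf : Antitone f) (hg : Antitone g)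
    (i : Fin m) {σ : ℝ} (hσ : σ = 1 ∨ σ = -1) :
    m < (Finset.univ.filter fun j => σ * f i ≤ σ * f j).card +
      (Finset.univ.filter fun j => σ * g j ≤ σ * g i).card := by
  have hi := i.2
  rcases hσ with rfl | rfl
  · have h1 : Finset.Iic i ⊆ Finset.univ.filter fun j => 1 * f i ≤ 1 * f j := fun j hj => by
      simpa using hf (Finset.mem_Iic.1 hj)
    have h2 : Finset.Ici i ⊆ Finset.univ.filter fun j => 1 * g j ≤ 1 * g i := fun j hj => by
      simpa using hg (Finset.mem_Ici.1 hj)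
    have h1 := Finset.card_le_card h1
    have h2 := Finset.card_le_card h2
    rw [Fin.card_Iic] at h1
    rw [Fin.card_Ici] at h2
    omega
  · have h1 : Finset.Ici i ⊆ Finset.univ.filter fun j => -1 * f i ≤ -1 * f j := fun j hj => by
      simpa using hf (Finset.mem_Ici.1 hj)
    have h2 : Finset.Iic i ⊆ Finset.univ.filter fun j => -1 * g j ≤ -1 * g i := fun j hj => by
      simpa using hg (Finset.mem_Iic.1 hj)
    have h1 := Finset.card_le_card h1
    have h2 := Finset.card_le_card h2
    rw [Fin.card_Ici] at h1
    rw [Fin.card_Iic] at h2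
    omega

theorem inner_eigenvectorBasis_apply {T : H →ₗ[ℂ] H} (hT : T.IsSymmetric)
    (hm : Module.finrank ℂ H = m) (x : H) (j : Fin m) :
    inner ℂ (hT.eigenvectorBasis hm j) (T x) =
      (hT.eigenvalues hm j : ℂ) * inner ℂ (hT.eigenvectorBasis hm j) x := by
  rw [← hT, hT.apply_eigenvectorBasis, inner_smul_left]
  simp

theorem re_inner_apply_eq_sum {T : H →ₗ[ℂ] H} (hT : T.IsSymmetric)
    (hm : Module.finrank ℂ H = m) (x : H) :
    (inner ℂ x (T x)).re =
      ∑ j, hT.eigenvalues hm j * ‖inner ℂ (hT.eigenvectorBasis hm j) x‖ ^ 2 := by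
  rw [← (hT.eigenvectorBasis hm).sum_inner_mul_inner, Complex.re_sum]
  refine Finset.sum_congr rfl fun j _ => ?_
  rw [inner_eigenvectorBasis_apply, mul_left_comm, Complex.re_ofReal_mul,
    show (inner ℂ x _ * inner ℂ _ x).re = _ from inner_mul_symm_re_eq_norm (𝕜 := ℂ) x _,
    norm_mul, norm_inner_symm, sq]

/-- A subspace-intersection argument in the style of Courant and Fischer. -/
theorem exists_eigenvalues_mul_le {T T₀ : H →ₗ[ℂ] H} (hT : T.IsSymmetric) (hT₀ : T₀.IsSymmetric)
    (hm : Module.finrank ℂ H = m) (i : Fin m) {σ : ℝ} (hσ : σ = 1 ∨ σ = -1) :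
    ∃ x : H, x ≠ 0 ∧ σ * hT.eigenvalues hm i * ‖x‖ ^ 2 ≤ σ * (inner ℂ x (T x)).re ∧
      ∀ j, inner ℂ (hT₀.eigenvectorBasis hm j) x ≠ 0 →
        σ * hT₀.eigenvalues hm j ≤ σ * hT₀.eigenvalues hm i := by
  obtain ⟨x, hx0, hx1, hx2⟩ := exists_ne_zero_inner_eq_zero (hT.eigenvectorBasis hm)
    (hT₀.eigenvectorBasis hm) _ _ (lt_card_add_card_of_antitone (hT.eigenvalues_antitone hm)
      (hT₀.eigenvalues_antitone hm) i hσ)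
  refine ⟨x, hx0, ?_, fun j hj => ?_⟩
  · rw [re_inner_apply_eq_sum hT hm, ← (hT.eigenvectorBasis hm).sum_sq_norm_inner_right, Finset.mul_sum,
      Finset.mul_sum]
    refine Finset.sum_le_sum fun j _ => ?_
    by_cases hj : σ * hT.eigenvalues hm i ≤ σ * hT.eigenvalues hm j
    · rw [← mul_assoc]
      gcongr
    · rw [hx1 j (by simpa using hj)]
      simp
  · by_contra hc
    exact hj (hx2 j (by simpa using hc))

theorem mul_norm_le_norm_apply_sub_smul {T : H →ₗ[ℂ] H} (hT : T.IsSymmetric)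
    (hm : Module.finrank ℂ H = m) {a d : ℝ} (hd : 0 ≤ d)
    (h : ∀ j, d ≤ |hT.eigenvalues hm j - a|) (y : H) :
    d * ‖y‖ ≤ ‖T y - (a : ℂ) • y‖ := by
  refine abs_le_of_sq_le_sq' ?_ (norm_nonneg _) |>.2
  rw [mul_pow, ← (hT.eigenvectorBasis hm).sum_sq_norm_inner_right, Finset.mul_sum,
    ← (hT.eigenvectorBasis hm).sum_sq_norm_inner_right]
  refine Finset.sum_le_sum fun j _ => ?_
  rw [inner_sub_right, inner_eigenvectorBasis_apply, inner_smul_right, ← sub_mul,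
    ← Complex.ofReal_sub, norm_mul, mul_pow, Complex.norm_real, Real.norm_eq_abs]
  have := h j
  gcongr

end Courant

/-! ### Quadratic bound on the eigenvalue shift. -/

section Perturbation

variable {p q : ℕ}

theorem eq_of_mem_spectrum_blockD₁ {lam₁ c : ℝ} (h : (c : ℂ) ∈ spectrum ℂ (blockD₁ p lam₁)) :
    c = lam₁ := by
  by_contra hc
  refine spectrum.mem_iff.1 h ?_
  have hu : IsUnit ((c : ℂ) - lam₁) :=
    isUnit_iff_ne_zero.2 (sub_ne_zero.2 (by exact_mod_cast hc))
  have := hu.map (algebraMap ℂ (Matrix (Fin p) (Fin p) ℂ))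
  rwa [map_sub, Algebra.algebraMap_eq_smul_one (lam₁ : ℂ)] at this

theorem gap_le_abs_sub {lam₁ c : ℝ} {D₂ : Matrix (Fin q) (Fin q) ℂ}
    {v : EuclideanSpace ℂ (Fin q)} (hv : v ≠ 0) (h : toLpLin 2 2 D₂ v = (c : ℂ) • v) :
    gap lam₁ D₂ ≤ |c - lam₁| := by
  have hc : (c : ℂ) ∈ spectrum ℂ D₂ := by
    rw [← spectrum_toLpLin 2]
    exact (Module.End.hasEigenvalue_of_hasEigenvector
      ⟨Module.End.mem_eigenspace_iff.2 h, hv⟩).mem_spectrum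
  refine csInf_le ⟨0, ?_⟩ ⟨_, hc, ?_⟩
  · rintro _ ⟨μ, -, rfl⟩
    exact norm_nonneg _
  · simp only
    rw [← Complex.ofReal_sub, Complex.norm_real, Real.norm_eq_abs, abs_sub_comm]

/-- The distance of `Λ(D₂)` from a real number `a`, bounded below through the gap. -/
theorem gap_sub_mul_norm_le (lam₁ a : ℝ) {D₂ : Matrix (Fin q) (Fin q) ℂ} (hD₂ : D₂.IsHermitian)
    (h : |a - lam₁| ≤ gap lam₁ D₂) (y : EuclideanSpace ℂ (Fin q)) :
    (gap lam₁ D₂ - |a - lam₁|) * ‖y‖ ≤ ‖toLpLin 2 2 D₂ y - (a : ℂ) • y‖ := by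
  have hT : (toLpLin 2 2 D₂).IsSymmetric := isSymmetric_toEuclideanLin_iff.mpr hD₂
  refine mul_norm_le_norm_apply_sub_smul hT finrank_euclideanSpace (sub_nonneg.2 h)
    (fun j => ?_) y
  have h1 := gap_le_abs_sub (lam₁ := lam₁) (c := hT.eigenvalues finrank_euclideanSpace j)
    ((hT.eigenvectorBasis finrank_euclideanSpace).orthonormal.ne_zero j)
    (hT.apply_eigenvectorBasis finrank_euclideanSpace j)
  have h2 := abs_sub_le (hT.eigenvalues finrank_euclideanSpace j) a lam₁
  linarith

theorem re_inner_perturbed (lam₁ : ℝ) (D₂ : Matrix (Fin q) (Fin q) ℂ)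
    (E₁ : Matrix (Fin p) (Fin q) ℂ) (t : ℝ) (x : EuclideanSpace ℂ (Fin p ⊕ Fin q)) :
    (inner ℂ x (toLpLin 2 2 (perturbed lam₁ D₂ E₁ t) x)).re =
      (inner ℂ x (toLpLin 2 2 (perturbed lam₁ D₂ E₁ 0) x)).re +
        2 * t * (inner ℂ (top x) (toLpLin 2 2 E₁ (bot x))).re := by
  have h : (inner ℂ (bot x) (toLpLin 2 2 E₁ᴴ (top x))).re =
      (inner ℂ (top x) (toLpLin 2 2 E₁ (bot x))).re := by
    rw [← inner_conj_symm, Complex.conj_re, inner_toLpLin_conjTranspose]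
  simp only [inner_eq_top_add_bot x, top_perturbed, bot_perturbed, inner_add_right,
    inner_smul_right, Complex.add_re, Complex.re_ofReal_mul, h]
  ring

/-- A positive gap keeps `λ₁` out of the spectrum of `D₂`, so no eigenvector of `D` mixes the
blocks. -/
theorem top_bot_of_eigenvector {lam₁ c : ℝ} {D₂ : Matrix (Fin q) (Fin q) ℂ}
    {E₁ : Matrix (Fin p) (Fin q) ℂ} (hg : 0 < gap lam₁ D₂)
    {x : EuclideanSpace ℂ (Fin p ⊕ Fin q)} (hx : x ≠ 0)
    (h : toLpLin 2 2 (perturbed lam₁ D₂ E₁ 0) x = (c : ℂ) • x) :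
    (c = lam₁ ∧ bot x = 0) ∨ (gap lam₁ D₂ ≤ |c - lam₁| ∧ top x = 0) := by
  have h1 : (lam₁ : ℂ) • top x = (c : ℂ) • top x := by
    simpa only [top_perturbed, Complex.ofReal_zero, zero_smul, add_zero, top_smul]
      using congrArg top h
  have h2 : toLpLin 2 2 D₂ (bot x) = (c : ℂ) • bot x := by
    simpa only [bot_perturbed, Complex.ofReal_zero, zero_smul, add_zero, bot_smul]
      using congrArg bot h
  by_cases hc : c = lam₁
  · refine Or.inl ⟨hc, ?_⟩
    by_contra hb
    have := gap_le_abs_sub (lam₁ := lam₁) hb h2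
    rw [hc, sub_self, abs_zero] at this
    linarith
  · have ht : top x = 0 := by
      by_contra ht
      exact hc (by exact_mod_cast (smul_left_injective ℂ ht h1).symm)
    refine Or.inr ⟨gap_le_abs_sub (fun hb => hx (ext_top_bot ht hb)) h2, ht⟩

/-- Every eigenvalue of `D` occurring in `x` either equals `λ₁` or lies beyond it by at least the
gap, on the side fixed by `σ`; the latter components make up the bottom part of `x`. -/
theorem re_inner_unperturbed_le (lam₁ : ℝ) {D₂ : Matrix (Fin q) (Fin q) ℂ}
    {E₁ : Matrix (Fin p) (Fin q) ℂ} (hg : 0 < gap lam₁ D₂)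
    (hT : (toLpLin 2 2 (perturbed lam₁ D₂ E₁ 0)).IsSymmetric) {m : ℕ}
    (hm : Module.finrank ℂ (EuclideanSpace ℂ (Fin p ⊕ Fin q)) = m) {σ : ℝ}
    (hσ : σ = 1 ∨ σ = -1) {x : EuclideanSpace ℂ (Fin p ⊕ Fin q)}
    (hx : ∀ j, inner ℂ (hT.eigenvectorBasis hm j) x ≠ 0 →
      σ * hT.eigenvalues hm j ≤ σ * lam₁) :
    σ * (inner ℂ x (toLpLin 2 2 (perturbed lam₁ D₂ E₁ 0) x)).re ≤
      σ * lam₁ * ‖x‖ ^ 2 - gap lam₁ D₂ * ‖bot x‖ ^ 2 := by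
  -- Padding `bot x` with zeros lets both squared norms be expanded in the same eigenbasis of `D`
  -- and compared term by term.
  have hb : ‖bot x‖ ^ 2 = ‖glue (0 : EuclideanSpace ℂ (Fin p)) (bot x)‖ ^ 2 := by
    rw [norm_sq_eq_top_add_bot]
    simp
  rw [re_inner_apply_eq_sum hT hm, hb, ← (hT.eigenvectorBasis hm).sum_sq_norm_inner_right,
    ← (hT.eigenvectorBasis hm).sum_sq_norm_inner_right, Finset.mul_sum, Finset.mul_sum,
    Finset.mul_sum, ← Finset.sum_sub_distrib]
  refine Finset.sum_le_sum fun j _ => ?_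
  have hsplit := inner_eq_top_add_bot (hT.eigenvectorBasis hm j) x
  have hglue : inner ℂ (hT.eigenvectorBasis hm j) (glue 0 (bot x)) =
      inner ℂ (bot (hT.eigenvectorBasis hm j)) (bot x) := by
    rw [inner_eq_top_add_bot]
    simp
  rcases top_bot_of_eigenvector (c := hT.eigenvalues hm j) hg
    ((hT.eigenvectorBasis hm).orthonormal.ne_zero j)
    (hT.apply_eigenvectorBasis hm j) with ⟨h1, h2⟩ | ⟨h1, h2⟩
  · rw [hglue, h2, inner_zero_left, norm_zero, h1]
    exact le_of_eq (by ring)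
  · rw [h2, inner_zero_left, zero_add] at hsplit
    rw [hglue, ← hsplit]
    by_cases h0 : inner ℂ (hT.eigenvectorBasis hm j) x = 0
    · simp [h0]
    · have h3 : σ * hT.eigenvalues hm j ≤ σ * lam₁ - gap lam₁ D₂ := by
        have := hx j h0
        rcases hσ with rfl | rfl
        · rw [abs_of_nonpos (by linarith)] at h1
          linarith
        · rw [abs_of_nonneg (by linarith)] at h1
          linarith
      nlinarith [mul_le_mul_of_nonneg_right h3
        (sq_nonneg ‖inner ℂ (hT.eigenvectorBasis hm j) x‖)]

/-- The eigenvalue `λ₁` moves by a quantity quadratic in the perturbation. -/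
theorem gap_mul_abs_eigenvalueAt_sub_le {lam₁ : ℝ} {D₂ : Matrix (Fin q) (Fin q) ℂ}
    (hD₂ : D₂.IsHermitian) (E₁ : Matrix (Fin p) (Fin q) ℂ) (hg : 0 < gap lam₁ D₂)
    {i : Fin (Fintype.card (Fin p ⊕ Fin q))} (hi : eigenvalueAt lam₁ hD₂ E₁ i 0 = lam₁)
    {t : ℝ} (ht : 0 ≤ t) :
    gap lam₁ D₂ * |eigenvalueAt lam₁ hD₂ E₁ i t - lam₁| ≤ (t * ‖E₁‖) ^ 2 := by
  have key : ∀ σ : ℝ, σ = 1 ∨ σ = -1 →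
      gap lam₁ D₂ * (σ * (eigenvalueAt lam₁ hD₂ E₁ i t - lam₁)) ≤ (t * ‖E₁‖) ^ 2 := by
    intro σ hσ
    have hT (s : ℝ) : (toLpLin 2 2 (perturbed lam₁ D₂ E₁ s)).IsSymmetric :=
      isSymmetric_toEuclideanLin_iff.mpr (isHermitian_perturbed lam₁ hD₂ E₁ s)
    obtain ⟨x, hx0, hx1, hx2⟩ :=
      exists_eigenvalues_mul_le (hT t) (hT 0) finrank_euclideanSpace i hσ
    change σ * eigenvalueAt lam₁ hD₂ E₁ i t * ‖x‖ ^ 2 ≤ _ at hx1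
    change ∀ j, _ → _ ≤ σ * eigenvalueAt lam₁ hD₂ E₁ i 0 at hx2
    rw [hi] at hx2
    have h1 := re_inner_unperturbed_le lam₁ hg (hT 0) finrank_euclideanSpace hσ hx2
    rw [re_inner_perturbed] at hx1
    have h2 : |(inner ℂ (top x) (toLpLin 2 2 E₁ (bot x))).re| ≤
        ‖top x‖ * (‖E₁‖ * ‖bot x‖) :=
      (Complex.abs_re_le_norm _).trans ((norm_inner_le_norm _ _).trans
        (mul_le_mul_of_nonneg_left (norm_toLpLin_le _ _) (norm_nonneg _)))
    set I := (inner ℂ (top x) (toLpLin 2 2 E₁ (bot x))).re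
    have h3 : σ * (2 * t * I) ≤ 2 * t * (‖top x‖ * (‖E₁‖ * ‖bot x‖)) := by
      have h4 : σ * I ≤ |I| := by
        rcases hσ with rfl | rfl
        · simpa using le_abs_self I
        · simpa using neg_le_abs I
      calc σ * (2 * t * I) = 2 * t * (σ * I) := by ring
        _ ≤ _ := mul_le_mul_of_nonneg_left (h4.trans h2) (by positivity)
    have h5 : σ * (eigenvalueAt lam₁ hD₂ E₁ i t - lam₁) * ‖x‖ ^ 2 ≤
        2 * t * (‖top x‖ * (‖E₁‖ * ‖bot x‖)) - gap lam₁ D₂ * ‖bot x‖ ^ 2 := by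
      linarith
    have hn := norm_sq_eq_top_add_bot x
    have hpos : 0 < ‖x‖ ^ 2 := by positivity
    refine le_of_mul_le_mul_right ?_ hpos
    -- After multiplication by the gap, the first square absorbs the cross term, leaving `(t ‖E₁‖
    -- ‖top x‖)²`; the second raises `‖top x‖²` to `‖x‖²`.
    nlinarith [mul_le_mul_of_nonneg_left h5 hg.le,
      sq_nonneg (t * ‖E₁‖ * ‖top x‖ - gap lam₁ D₂ * ‖bot x‖), sq_nonneg (t * ‖E₁‖ * ‖bot x‖)]
  rcases abs_choice (eigenvalueAt lam₁ hD₂ E₁ i t - lam₁) with h | h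
  · simpa [h] using key 1 (Or.inl rfl)
  · rw [h]
    simpa only [neg_one_mul] using key (-1) (Or.inr rfl)

end Perturbation

/-! ### Equations and inequalities for the remainder. -/

section Remainder

variable {p q : ℕ}

theorem toLpLin_conjTranspose_eq {lam₁ : ℝ} {D₂ : Matrix (Fin q) (Fin q) ℂ}
    (hD₂ : D₂.IsHermitian) {E₁ B₁ : Matrix (Fin p) (Fin q) ℂ}
    (hE : E₁ = blockD₁ p lam₁ * B₁ - B₁ * D₂) (u : EuclideanSpace ℂ (Fin p)) :
    toLpLin 2 2 E₁ᴴ u =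
      (lam₁ : ℂ) • toLpLin 2 2 B₁ᴴ u - toLpLin 2 2 D₂ (toLpLin 2 2 B₁ᴴ u) := by
  have h : E₁ᴴ = (lam₁ : ℂ) • B₁ᴴ - D₂ * B₁ᴴ := by
    rw [hE, blockD₁, conjTranspose_sub, conjTranspose_mul B₁, hD₂.eq]
    simp
  rw [h]
  ext a
  simp [smul_mulVec]

/-- `E₁* = (λ₁ - D₂) B₁*`, and `λ₁ - D₂` is bounded below by the gap. -/
theorem gap_mul_norm_le {lam₁ : ℝ} {D₂ : Matrix (Fin q) (Fin q) ℂ}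
    (hD₂ : D₂.IsHermitian) {E₁ B₁ : Matrix (Fin p) (Fin q) ℂ}
    (hE : E₁ = blockD₁ p lam₁ * B₁ - B₁ * D₂) (hg : 0 < gap lam₁ D₂) :
    gap lam₁ D₂ * ‖B₁‖ ≤ ‖E₁‖ := by
  rw [← l2_opNorm_conjTranspose B₁, ← le_div_iff₀' hg]
  refine norm_le_of_forall_toLpLin (by positivity) fun u => ?_
  rw [div_mul_eq_mul_div, le_div_iff₀' hg]
  have h := gap_sub_mul_norm_le lam₁ lam₁ hD₂ (by simpa using hg.le) (toLpLin 2 2 B₁ᴴ u)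
  rw [sub_self, abs_zero, sub_zero, norm_sub_rev, ← toLpLin_conjTranspose_eq hD₂ hE] at h
  rw [← l2_opNorm_conjTranspose E₁]
  exact h.trans (norm_toLpLin_le _ _)

theorem eigenvector_equation {lam₁ : ℝ} {D₂ : Matrix (Fin q) (Fin q) ℂ}
    {hD₂ : D₂.IsHermitian} {E₁ : Matrix (Fin p) (Fin q) ℂ}
    {i : Fin (Fintype.card (Fin p ⊕ Fin q))} {t : ℝ} {x : EuclideanSpace ℂ (Fin p ⊕ Fin q)}
    (hx : IsUnitEigenvectorAt lam₁ hD₂ E₁ i t x) :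
    toLpLin 2 2 (perturbed lam₁ D₂ E₁ t) x = (eigenvalueAt lam₁ hD₂ E₁ i t : ℂ) • x :=
  congrArg (WithLp.toLp 2) hx.2

theorem top_eq_of_isDecomposition {B₁ : Matrix (Fin p) (Fin q) ℂ} {t : ℝ}
    {x : EuclideanSpace ℂ (Fin p ⊕ Fin q)} {u : EuclideanSpace ℂ (Fin p)}
    {r : EuclideanSpace ℂ (Fin q)} (h : IsDecomposition B₁ t x u r) : top x = u := by
  ext a
  simpa [top, fromRows_mulVec] using congrFun h (Sum.inl a)

theorem bot_eq_of_isDecomposition {B₁ : Matrix (Fin p) (Fin q) ℂ} {t : ℝ}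
    {x : EuclideanSpace ℂ (Fin p ⊕ Fin q)} {u : EuclideanSpace ℂ (Fin p)}
    {r : EuclideanSpace ℂ (Fin q)} (h : IsDecomposition B₁ t x u r) :
    bot x = (t : ℂ) • toLpLin 2 2 B₁ᴴ u + r := by
  ext b
  simpa [bot, fromRows_mulVec, blockB₂, smul_mulVec] using congrFun h (Sum.inr b)

/-- The norm inequalities satisfied by the pieces of a normalized eigenvector. -/
theorem remainder_inequalities {lam₁ : ℝ} {D₂ : Matrix (Fin q) (Fin q) ℂ}
    {hD₂ : D₂.IsHermitian} {E₁ B₁ : Matrix (Fin p) (Fin q) ℂ}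
    (hE : E₁ = blockD₁ p lam₁ * B₁ - B₁ * D₂)
    {i : Fin (Fintype.card (Fin p ⊕ Fin q))} {t : ℝ} (ht : 0 ≤ t)
    {x : EuclideanSpace ℂ (Fin p ⊕ Fin q)} (hx : IsUnitEigenvectorAt lam₁ hD₂ E₁ i t x)
    {u : EuclideanSpace ℂ (Fin p)} {r : EuclideanSpace ℂ (Fin q)}
    (hd : IsDecomposition B₁ t x u r) {η : ℝ}
    (hη : η = |eigenvalueAt lam₁ hD₂ E₁ i t - lam₁|) (hηg : η ≤ gap lam₁ D₂) :
    ‖u‖ ^ 2 + ‖bot x‖ ^ 2 = 1 ∧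
      (gap lam₁ D₂ - η) * ‖r‖ ≤ t * η * ‖B₁‖ * ‖u‖ ∧
      η * ‖u‖ ≤ t * ‖E₁‖ * ‖bot x‖ ∧
      (gap lam₁ D₂ - η) * ‖bot x‖ ≤ t * ‖E₁‖ * ‖u‖ ∧
      η * ‖u‖ ^ 2 ≤ t ^ 2 / 2 * ‖B₁ * E₁ᴴ + E₁ * B₁ᴴ‖ * ‖u‖ ^ 2 + t * ‖E₁‖ * ‖u‖ * ‖r‖ := by
  have htop := top_eq_of_isDecomposition hd
  have hbot := bot_eq_of_isDecomposition hd
  have heq := eigenvector_equation hx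
  set a := eigenvalueAt lam₁ hD₂ E₁ i t
  have h1 : ((a - lam₁ : ℝ) : ℂ) • u = (t : ℂ) • toLpLin 2 2 E₁ (bot x) := by
    have := congrArg top heq
    rw [top_perturbed, top_smul, htop] at this
    rw [Complex.ofReal_sub, sub_smul, ← this]
    abel
  have h2 : toLpLin 2 2 D₂ (bot x) - (a : ℂ) • bot x = -((t : ℂ) • toLpLin 2 2 E₁ᴴ u) := by
    have := congrArg bot heq
    rw [bot_perturbed, bot_smul, htop] at this
    rw [← this]
    abel
  have h3 : toLpLin 2 2 D₂ r - (a : ℂ) • r =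
      ((t * (a - lam₁) : ℝ) : ℂ) • toLpLin 2 2 B₁ᴴ u := by
    -- The term `t B₁* u` solves the bottom equation with `a` replaced by `λ₁`, so only the shift `a
    -- - λ₁` drives `r`.
    rw [hbot, map_add, map_smul, toLpLin_conjTranspose_eq hD₂ hE] at h2
    have h4 : toLpLin 2 2 D₂ r - (a : ℂ) • r =
        ((t : ℂ) • toLpLin 2 2 D₂ (toLpLin 2 2 B₁ᴴ u) + toLpLin 2 2 D₂ r -
          (a : ℂ) • ((t : ℂ) • toLpLin 2 2 B₁ᴴ u + r)) -
        ((t : ℂ) • toLpLin 2 2 D₂ (toLpLin 2 2 B₁ᴴ u) -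
          (a : ℂ) • ((t : ℂ) • toLpLin 2 2 B₁ᴴ u)) := by
      rw [smul_add]
      abel
    rw [h4, h2]
    push_cast
    module
  have hη0 : 0 ≤ η := hη ▸ abs_nonneg _
  have hgap (y : EuclideanSpace ℂ (Fin q)) :
      (gap lam₁ D₂ - η) * ‖y‖ ≤ ‖toLpLin 2 2 D₂ y - (a : ℂ) • y‖ := by
    rw [hη] at hηg ⊢
    exact gap_sub_mul_norm_le lam₁ a hD₂ hηg y
  have hB := norm_toLpLin_le B₁ᴴ u
  have hE' := norm_toLpLin_le E₁ᴴ u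
  rw [l2_opNorm_conjTranspose] at hB hE'
  have habs : ‖((a - lam₁ : ℝ) : ℂ)‖ = η := by rw [hη, Complex.norm_real, Real.norm_eq_abs]
  have hnt : ‖(t : ℂ)‖ = t := by rw [Complex.norm_real, Real.norm_of_nonneg ht]
  refine ⟨?_, ?_, ?_, ?_, ?_⟩
  · rw [← htop, ← norm_sq_eq_top_add_bot, hx.1, one_pow]
  · refine (hgap r).trans ?_
    rw [h3, norm_smul, Complex.ofReal_mul, norm_mul, habs, hnt, mul_assoc (t * η)]
    gcongr
  · rw [← habs, ← norm_smul, h1, norm_smul, hnt, mul_assoc]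
    exact mul_le_mul_of_nonneg_left (norm_toLpLin_le _ _) ht
  · refine (hgap _).trans ?_
    rw [h2, norm_neg, norm_smul, hnt, mul_assoc]
    gcongr
  · have h5 : (a - lam₁) * ‖u‖ ^ 2 = t * (inner ℂ u (toLpLin 2 2 E₁ (bot x))).re := by
      have := congrArg (fun z => (inner ℂ u z).re) h1
      simp only [inner_smul_right, Complex.re_ofReal_mul] at this
      rw [← this, show (inner ℂ u u).re = ‖u‖ ^ 2 from inner_self_eq_norm_sq (𝕜 := ℂ) u]
    -- The products `E₁ B₁*` and `B₁ E₁*` are adjoint to each other, so their quadratic forms have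
    -- equal real parts; this is the source of the factor `1/2`.
    have h6 : (inner ℂ u (toLpLin 2 2 E₁ (toLpLin 2 2 B₁ᴴ u))).re =
        (inner ℂ u (toLpLin 2 2 (B₁ * E₁ᴴ + E₁ * B₁ᴴ) u)).re / 2 := by
      have h7 : toLpLin 2 2 (B₁ * E₁ᴴ + E₁ * B₁ᴴ) u =
          toLpLin 2 2 B₁ (toLpLin 2 2 E₁ᴴ u) + toLpLin 2 2 E₁ (toLpLin 2 2 B₁ᴴ u) := by
        ext a
        simp
      have h8 : (inner ℂ u (toLpLin 2 2 B₁ (toLpLin 2 2 E₁ᴴ u))).re =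
          (inner ℂ u (toLpLin 2 2 E₁ (toLpLin 2 2 B₁ᴴ u))).re := by
        rw [← inner_toLpLin_conjTranspose, ← inner_toLpLin_conjTranspose, ← inner_conj_symm,
          Complex.conj_re, conjTranspose_conjTranspose]
      rw [h7, inner_add_right, Complex.add_re, h8]
      ring
    have hre {m : ℕ} (A : Matrix (Fin p) (Fin m) ℂ) (y : EuclideanSpace ℂ (Fin m)) :
        |(inner ℂ u (toLpLin 2 2 A y)).re| ≤ ‖u‖ * (‖A‖ * ‖y‖) :=
      (Complex.abs_re_le_norm _).trans ((norm_inner_le_norm _ _).trans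
        (mul_le_mul_of_nonneg_left (norm_toLpLin_le _ _) (norm_nonneg _)))
    have h9 : (a - lam₁) * ‖u‖ ^ 2 =
        t ^ 2 / 2 * (inner ℂ u (toLpLin 2 2 (B₁ * E₁ᴴ + E₁ * B₁ᴴ) u)).re +
          t * (inner ℂ u (toLpLin 2 2 E₁ r)).re := by
      rw [h5, hbot, map_add, map_smul, inner_add_right, inner_smul_right, Complex.add_re,
        Complex.re_ofReal_mul, h6]
      ring
    rw [show η * ‖u‖ ^ 2 = |(a - lam₁) * ‖u‖ ^ 2| by rw [abs_mul, ← hη, abs_pow, abs_norm], h9]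
    refine (abs_add_le _ _).trans ?_
    rw [abs_mul, abs_mul, abs_of_nonneg ht, abs_of_nonneg (by positivity : 0 ≤ t ^ 2 / 2)]
    refine (add_le_add (mul_le_mul_of_nonneg_left (hre _ u) (by positivity))
      (mul_le_mul_of_nonneg_left (hre _ r) ht)).trans (le_of_eq ?_)
    ring

end Remainder

/-! ### Real-number estimates behind the two bounds. -/

section Scalar

variable {g e b s t η U V R : ℝ}

/-- Source of the constant `2/3`. If `e ≥ g/2`, then `V ≤ 1` and `g (g - η) ≥ (g - e)(g + e)` with
`g + e ≥ 3g/2`. If `e ≤ g/2`, then `(g - η) V ≤ e`, and `e (g - e) ≤ g²/4` while `g - η ≥ 3g/4`. -/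
theorem sub_mul_le_two_thirds (he : 0 ≤ e) (heg : e < g) (ht : t ∈ Set.Icc (0 : ℝ) 1)
    (hη : g * η ≤ (t * e) ^ 2) (hV : 0 ≤ V) (hU : U ^ 2 + V ^ 2 = 1)
    (h : (g - η) * V ≤ t * e * U) : V * (g - e) ≤ 2 / 3 * (g - η) := by
  have hg : 0 < g := he.trans_lt heg
  have hte : t * e ≤ e := by nlinarith [ht.2]
  have hη' : g * η ≤ e ^ 2 := hη.trans (pow_le_pow_left₀ (mul_nonneg ht.1 he) hte 2)
  rcases le_total (g / 2) e with h' | h'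
  · have hV1 : V ≤ 1 := by nlinarith [sq_nonneg U]
    have : g * (V * (g - e)) ≤ g * (2 / 3 * (g - η)) := by
      nlinarith [mul_le_mul_of_nonneg_right hV1 (mul_nonneg hg.le (sub_nonneg.2 heg.le)),
        mul_nonneg (sub_nonneg.2 heg.le) (sub_nonneg.2 h')]
    exact le_of_mul_le_mul_left this hg
  · have hU1 : U ≤ 1 := by nlinarith [sq_nonneg V]
    have h1 : (g - η) * V ≤ e := by
      refine h.trans ?_
      nlinarith [mul_le_mul_of_nonneg_left hU1 (mul_nonneg ht.1 he)]
    have h2 : 3 / 4 * g ≤ g - η := by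
      have : g * η ≤ g * (g / 4) := by nlinarith
      linarith [le_of_mul_le_mul_left this hg]
    have h3 : e * (g - e) ≤ 2 / 3 * (g - η) ^ 2 := by
      nlinarith [sq_nonneg (g - 2 * e), mul_nonneg hg.le (sub_nonneg.2 h2)]
    have hδ : 0 < g - η := by linarith
    refine le_of_mul_le_mul_left ?_ hδ
    nlinarith [mul_le_mul_of_nonneg_right h1 (sub_nonneg.2 heg.le)]

theorem le_sub_of_mul_le_sq (he : 0 ≤ e) (heg : e < g) (ht : t ∈ Set.Icc (0 : ℝ) 1)
    (hη : g * η ≤ (t * e) ^ 2) : g - e ≤ g - η := by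
  have hg : 0 < g := he.trans_lt heg
  have hte : t * e ≤ e := by nlinarith [ht.2]
  have hη' : g * η ≤ e ^ 2 := hη.trans (pow_le_pow_left₀ (mul_nonneg ht.1 he) hte 2)
  have : g * η ≤ g * e := by nlinarith
  linarith [le_of_mul_le_mul_left this hg]

theorem remainder_le_of_inequalities (he : 0 ≤ e) (heg : e < g) (ht : t ∈ Set.Icc (0 : ℝ) 1)
    (hb : 0 ≤ b) (hs : 0 ≤ s) (hη : g * η ≤ (t * e) ^ 2) (hU0 : 0 ≤ U) (hV : 0 ≤ V) (hR : 0 ≤ R)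
    (hU : U ^ 2 + V ^ 2 = 1) (h1 : (g - η) * R ≤ t * η * b * U) (h2 : η * U ≤ t * e * V)
    (h3 : (g - η) * V ≤ t * e * U)
    (h4 : η * U ^ 2 ≤ t ^ 2 / 2 * s * U ^ 2 + t * e * U * R) :
    R ≤ 1 / (g - e) * (t ^ 2 / 2 * b * s + 2 / 3 * t ^ 3 * (b ^ 2 * e ^ 2 / (g - e))) := by
  obtain ⟨ht0, ht1⟩ := ht
  have hge : 0 < g - e := sub_pos.2 heg
  have hδe := le_sub_of_mul_le_sq he heg ⟨ht0, ht1⟩ hη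
  have hδ : 0 < g - η := hge.trans_le hδe
  have hV23 := sub_mul_le_two_thirds he heg ⟨ht0, ht1⟩ hη hV hU h3
  have hU1 : U ≤ 1 := by nlinarith [sq_nonneg V]
  -- A first bound on `R`, from `η U ≤ t e V`, to be reinserted in the last term of `h4`.
  have h5 : R ≤ t ^ 2 * b * e * (2 / 3 / (g - e)) := by
    have hVδ : V / (g - η) ≤ 2 / 3 / (g - e) := by
      rw [div_le_div_iff₀ hδ hge]
      exact hV23
    have h6 : R ≤ t ^ 2 * b * e * (V / (g - η)) := by
      rw [← mul_div_assoc, le_div_iff₀' hδ]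
      refine h1.trans ?_
      nlinarith [mul_le_mul_of_nonneg_left h2 (mul_nonneg ht0 hb)]
    exact h6.trans (mul_le_mul_of_nonneg_left hVδ (by positivity))
  -- The inequality `h4` is divided by `U`; when `U = 0` the left side vanishes.
  have h7 : η * U ≤ t ^ 2 / 2 * s + t * e * R := by
    rcases hU0.eq_or_lt with h0 | h0
    · rw [← h0, mul_zero]
      positivity
    · have h8 : η * U ≤ t ^ 2 / 2 * s * U + t * e * R :=
        le_of_mul_le_mul_right (by linarith) h0
      have h9 : t ^ 2 / 2 * s * U ≤ t ^ 2 / 2 * s :=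
        mul_le_of_le_one_right (by positivity) hU1
      linarith
  have h8 : (g - e) * R ≤ t * b * (t ^ 2 / 2 * s + t * e * (t ^ 2 * b * e * (2 / 3 / (g - e)))) := by
    calc (g - e) * R ≤ (g - η) * R := mul_le_mul_of_nonneg_right hδe hR
      _ ≤ t * b * (η * U) := by linarith
      _ ≤ t * b * (t ^ 2 / 2 * s + t * e * R) := by gcongr
      _ ≤ _ := by gcongr
  rw [one_div, inv_mul_eq_div, le_div_iff₀' hge]
  refine h8.trans ?_
  have h9 : t * b * (t ^ 2 / 2 * s + t * e * (t ^ 2 * b * e * (2 / 3 / (g - e)))) =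
      t * (t ^ 2 / 2 * b * s + 2 / 3 * t ^ 3 * (b ^ 2 * e ^ 2 / (g - e))) := by
    ring
  rw [h9]
  -- The argument yields one more factor `t` than claimed, and it is discarded.
  exact mul_le_of_le_one_left (by positivity) ht1

theorem remainder_le_cube (he : 0 ≤ e) (heg : e < g) (ht : t ∈ Set.Icc (0 : ℝ) 1)
    (hb : 0 ≤ b) (hbe : g * b ≤ e) (hη : g * η ≤ (t * e) ^ 2) (hV : 0 ≤ V) (hR : 0 ≤ R)
    (hU : U ^ 2 + V ^ 2 = 1) (h1 : (g - η) * R ≤ t * η * b * U) (h2 : η * U ≤ t * e * V)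
    (h3 : (g - η) * V ≤ t * e * U) :
    R ≤ (1 / (1 - e / g)) ^ 2 * (e / g) ^ 3 := by
  obtain ⟨ht0, ht1⟩ := ht
  have hg : 0 < g := he.trans_lt heg
  have hge : 0 < g - e := sub_pos.2 heg
  have hδe := le_sub_of_mul_le_sq he heg ⟨ht0, ht1⟩ hη
  have hU1 : U ≤ 1 := by nlinarith [sq_nonneg V]
  have hV' : (g - e) * V ≤ e :=
    calc (g - e) * V ≤ (g - η) * V := mul_le_mul_of_nonneg_right hδe hV
      _ ≤ t * e * U := h3
      _ ≤ t * e * 1 := by gcongr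
      _ ≤ 1 * e * 1 := by gcongr
      _ = e := by ring
  have hR' : (g - e) * R ≤ b * e * V :=
    calc (g - e) * R ≤ (g - η) * R := mul_le_mul_of_nonneg_right hδe hR
      _ ≤ t * b * (η * U) := by linarith
      _ ≤ t * b * (t * e * V) := by gcongr
      _ ≤ 1 * b * (1 * e * V) := by gcongr
      _ = b * e * V := by ring
  have h4 : R * (g * (g - e) ^ 2) ≤ e ^ 3 :=
    calc R * (g * (g - e) ^ 2) = g * (g - e) * ((g - e) * R) := by ring
      _ ≤ g * (g - e) * (b * e * V) := by gcongr
      _ = (g * b) * e * ((g - e) * V) := by ring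
      _ ≤ e * e * e := by gcongr
      _ = e ^ 3 := by ring
  rw [show (1 / (1 - e / g)) ^ 2 * (e / g) ^ 3 = e ^ 3 / (g * (g - e) ^ 2) by
    have : 1 - e / g = (g - e) / g := by field_simp
    rw [this]
    field_simp]
  rwa [le_div_iff₀ (by positivity)]

end Scalar

end BlockPerturbation

/-! ### Assembly of the two bounds. -/

theorem mainTheorem5 :
    -- The explicit bound on the remainder.
    (∀ (p q : ℕ) (lam₁ : ℝ) (D₂ : Matrix (Fin q) (Fin q) ℂ) (hD₂ : D₂.IsHermitian)
        (E₁ B₁ : Matrix (Fin p) (Fin q) ℂ),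
        E₁ = BlockPerturbation.blockD₁ p lam₁ * B₁ - B₁ * D₂ →
        ‖E₁‖ < BlockPerturbation.gap lam₁ D₂ →
      ∀ i : Fin (Fintype.card (Fin p ⊕ Fin q)),
        (BlockPerturbation.eigenvalueAt lam₁ hD₂ E₁ i 0 : ℂ) ∈
          spectrum ℂ (BlockPerturbation.blockD₁ p lam₁) →
      ∀ t ∈ Set.Icc (0 : ℝ) 1, ∀ x : EuclideanSpace ℂ (Fin p ⊕ Fin q),
        BlockPerturbation.IsUnitEigenvectorAt lam₁ hD₂ E₁ i t x →
      ∀ (xtop : EuclideanSpace ℂ (Fin p)) (r : EuclideanSpace ℂ (Fin q)),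
        BlockPerturbation.IsDecomposition B₁ t x xtop r →
        ‖r‖ ≤ 1 / (BlockPerturbation.gap lam₁ D₂ - ‖E₁‖) *
          (t ^ 2 / 2 * ‖B₁‖ * ‖B₁ * E₁.conjTranspose + E₁ * B₁.conjTranspose‖ +
            2 / 3 * t ^ 3 *
              (‖B₁‖ ^ 2 * ‖E₁‖ ^ 2 / (BlockPerturbation.gap lam₁ D₂ - ‖E₁‖)))) ∧
    -- The remainder is cubic in `‖E‖ / gap`, as long as this ratio stays away from `1`.
    (∀ ρ₀ : ℝ, ρ₀ < 1 → ∃ C : ℝ, 0 < C ∧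
      ∀ (p q : ℕ) (lam₁ : ℝ) (D₂ : Matrix (Fin q) (Fin q) ℂ) (hD₂ : D₂.IsHermitian)
        (E₁ B₁ : Matrix (Fin p) (Fin q) ℂ),
        E₁ = BlockPerturbation.blockD₁ p lam₁ * B₁ - B₁ * D₂ →
        0 < BlockPerturbation.gap lam₁ D₂ →
        ‖BlockPerturbation.blockE E₁‖ / BlockPerturbation.gap lam₁ D₂ ≤ ρ₀ →
      ∀ i : Fin (Fintype.card (Fin p ⊕ Fin q)),
        (BlockPerturbation.eigenvalueAt lam₁ hD₂ E₁ i 0 : ℂ) ∈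
          spectrum ℂ (BlockPerturbation.blockD₁ p lam₁) →
      ∀ t ∈ Set.Icc (0 : ℝ) 1, ∀ x : EuclideanSpace ℂ (Fin p ⊕ Fin q),
        BlockPerturbation.IsUnitEigenvectorAt lam₁ hD₂ E₁ i t x →
      ∀ (xtop : EuclideanSpace ℂ (Fin p)) (r : EuclideanSpace ℂ (Fin q)),
        BlockPerturbation.IsDecomposition B₁ t x xtop r →
        ‖r‖ ≤ C * (‖BlockPerturbation.blockE E₁‖ / BlockPerturbation.gap lam₁ D₂) ^ 3) := by
  -- The constant is the prefactor in `remainder_le_cube` with `e / g` replaced by its upper bound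
  -- `ρ₀`.
  refine ⟨?_, fun ρ₀ hρ₀ => ⟨(1 / (1 - ρ₀)) ^ 2, by have := sub_pos.2 hρ₀; positivity, ?_⟩⟩
  · intro p q lam₁ D₂ hD₂ E₁ B₁ hE heg i hi t ht x hx u r hd
    have hg := (norm_nonneg E₁).trans_lt heg
    have hη := BlockPerturbation.gap_mul_abs_eigenvalueAt_sub_le hD₂ E₁ hg
      (BlockPerturbation.eq_of_mem_spectrum_blockD₁ hi) ht.1
    have hδ := BlockPerturbation.le_sub_of_mul_le_sq (norm_nonneg _) heg ht hη
    obtain ⟨h1, h2, h3, h4, h5⟩ := BlockPerturbation.remainder_inequalities hE ht.1 hx hd rfl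
      (by linarith)
    exact BlockPerturbation.remainder_le_of_inequalities (norm_nonneg _) heg ht (norm_nonneg _)
      (norm_nonneg _) hη (norm_nonneg _) (norm_nonneg _) (norm_nonneg _) h1 h2 h3 h4 h5
  · intro p q lam₁ D₂ hD₂ E₁ B₁ hE hg hρ i hi t ht x hx u r hd
    have hle : ‖E₁‖ / BlockPerturbation.gap lam₁ D₂ ≤
        ‖BlockPerturbation.blockE E₁‖ / BlockPerturbation.gap lam₁ D₂ :=
      div_le_div_of_nonneg_right (BlockPerturbation.norm_le_norm_blockE E₁) hg.le
    have heg : ‖E₁‖ < BlockPerturbation.gap lam₁ D₂ :=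
      (div_lt_one hg).1 ((hle.trans hρ).trans_lt hρ₀)
    have hη := BlockPerturbation.gap_mul_abs_eigenvalueAt_sub_le hD₂ E₁ hg
      (BlockPerturbation.eq_of_mem_spectrum_blockD₁ hi) ht.1
    have hδ := BlockPerturbation.le_sub_of_mul_le_sq (norm_nonneg _) heg ht hη
    obtain ⟨h1, h2, h3, h4, -⟩ := BlockPerturbation.remainder_inequalities hE ht.1 hx hd rfl
      (by linarith)
    refine (BlockPerturbation.remainder_le_cube (norm_nonneg _) heg ht (norm_nonneg _)
      (BlockPerturbation.gap_mul_norm_le hD₂ hE hg) hη (norm_nonneg _) (norm_nonneg _)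
      h1 h2 h3 h4).trans ?_
    have := sub_pos.2 hρ₀
    have hle' := hle.trans hρ
    gcongr
    exact one_div_nonneg.2 (by linarith)
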